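/- **Theorem (Chiribella's formula).** Let $\mathfrak{H}$ be a complex Hilbert space of finite dimension $d \ge 1$. For $n \ge 0$ write $\mathfrak{H}^{n} = \mathfrak{H}^{\otimes n}$ for the $n$-fold Hilbert space tensor power and $\mathfrak{H}_s^n \subset \mathfrak{H}^{n}$ for its symmetric (bosonic) subspace, i.e. the vectors invariant under all permutations of the factors. Let $du$ be the uniform probability measure on the unit sphere $S\mathfrak{H} = \{u \in \mathfrak{H} : \|u\| = 1\}$. Let $0 \le n \le N$ and let $\Gamma_N$ be a bosonic state on $\mathfrak{H}_s^N$, i.e. a positive self-adjoint operator on $\mathfrak{H}_s^N$ with $\operatorname{Tr}\Gamma_N = 1$. Put $$\tilde{\Gamma}_N = \dim(\mathfrak{H}_s^N) \int_{S\mathfrak{H}} |u^{\otimes N}\rangle\langle u^{\otimes N}|\; \langle u^{\otimes N}, \Gamma_N u^{\otimes N}\rangle \, du .$$ For $0 \le \ell \le N$ let $\gamma_N^{(\ell)} = \operatorname{Tr}_{\ell+1\to N}\Gamma_N$ and $\tilde\gamma_N^{(\ell)} = \operatorname{Tr}_{\ell+1\to N}\tilde\Gamma_N$ be the reduced density matrices,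 obtained by partial trace over the last $N-\ell$ factors, where an operator on $\mathfrak{H}_s^N$ is regarded as an operator on $\mathfrak{H}^N$ vanishing on the orthogonal complement of $\mathfrak{H}_s^N$ (so $\operatorname{Tr}\gamma_N^{(\ell)} = 1$). Then, as operators on $\mathfrak{H}_s^n$, $$\tilde{\gamma}_N^{(n)} = \binom{N+n+d-1}{n}^{-1} \sum_{\ell=0}^{n} \binom{N}{\ell}\, \gamma_N^{(\ell)} \otimes_s \mathbf{1}_{\mathfrak{H}^{n-\ell}},$$ where $$\gamma_N^{(\ell)} \otimes_s \mathbf{1}_{\mathfrak{H}^{n-\ell}} = \frac{1}{\ell!\,(n-\ell)!} \sum_{\sigma \in S_n} \bigl(\gamma_N^{(\ell)}\bigr)_{\sigma(1),\dots,\sigma(\ell)} \otimes \bigl(\mathbf{1}_{\mathfrak{H}^{n-\ell}}\bigr)_{\sigma(\ell+1),\dots,\sigma(n)}$$ and $(\gamma_N^{(\ell)})_{\sigma(1),\dots,\sigma(\ell)}$ acts on the tensor factors number $\sigma(1),\dots,\sigma(\ell)$. -/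

import Mathlib

open scoped TensorProduct ComplexConjugate

noncomputable section

section TensorPower

variable (H : Type*) [NormedAddCommGroup H] [InnerProductSpace ℂ H]

/-- The `n`-fold tensor power `H^{⊗n}` (for finite-dimensional `H`, so that no completion is
needed). A type of its own, since it carries the Hilbert space norm defined below. -/
def TensorPow (n : ℕ) : Type _ := ⨂[ℂ] _ : Fin n, H

variable {H}

/-- The elementary tensor `v₁ ⊗ ⋯ ⊗ vₙ`. -/
def elemTensor {n : ℕ} (v : Fin n → H) : TensorPow H n :=
  PiTensorProduct.tprod ℂ v

variable [FiniteDimensional ℂ H]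

variable (H) in
/-- The basis of the algebraic tensor power made of the elementary tensors of vectors of an
orthonormal basis of `H`. -/
def tensorPowBasis (n : ℕ) :
    Module.Basis (Fin n → Fin (Module.finrank ℂ H)) ℂ (⨂[ℂ] _ : Fin n, H) :=
  Basis.piTensorProduct (fun _ => (stdOrthonormalBasis ℂ H).toBasis)

variable (H) in
/-- The inner product of `H^{⊗n}`, in coordinates. It does not depend on the choice of the
orthonormal basis: it is characterized by `inner_elemTensor` below. -/
@[reducible] def tensorPowCore (n : ℕ) : InnerProductSpace.Core ℂ (⨂[ℂ] _ : Fin n, H) where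
  inner x y := ∑ p, conj ((tensorPowBasis H n).repr x p) * (tensorPowBasis H n).repr y p
  conj_inner_symm x y := by
    simp [mul_comm]
  re_inner_nonneg x := by
    rw [map_sum]
    refine Finset.sum_nonneg fun p _ => ?_
    rw [RCLike.conj_mul]
    norm_cast
    positivity
  add_left x y z := by
    simp [add_mul, Finset.sum_add_distrib]
  smul_left x y r := by
    simp [Finset.mul_sum, mul_assoc]
  definite x hx := by
    have h1 : (∑ p, ‖(tensorPowBasis H n).repr x p‖ ^ 2 : ℝ) = 0 := by
      have h2 : ((∑ p, ‖(tensorPowBasis H n).repr x p‖ ^ 2 : ℝ) : ℂ) = 0 := by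
        rw [← hx]
        push_cast
        exact Finset.sum_congr rfl fun p _ => (RCLike.conj_mul _).symm
      exact_mod_cast h2
    rw [Finset.sum_eq_zero_iff_of_nonneg (fun p _ => by positivity)] at h1
    refine (tensorPowBasis H n).ext_elem fun p => ?_
    simpa using h1 p (Finset.mem_univ p)

instance (n : ℕ) : NormedAddCommGroup (TensorPow H n) :=
  (tensorPowCore H n).toNormedAddCommGroup

instance (n : ℕ) : InnerProductSpace ℂ (TensorPow H n) :=
  InnerProductSpace.ofCore (tensorPowCore H n).toCore

variable (H) in
/-- The tautological identification of `H^{⊗n}` with Mathlib's algebraic tensor power. -/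
def TensorPow.equivPi (n : ℕ) : TensorPow H n ≃ₗ[ℂ] ⨂[ℂ] _ : Fin n, H :=
  LinearEquiv.refl ℂ (⨂[ℂ] _ : Fin n, H)

instance (n : ℕ) : FiniteDimensional ℂ (TensorPow H n) :=
  Module.Finite.equiv (TensorPow.equivPi H n).symm

theorem tensorPowBasis_repr_tprod {n : ℕ} (v : Fin n → H)
    (p : Fin n → Fin (Module.finrank ℂ H)) :
    (tensorPowBasis H n).repr (PiTensorProduct.tprod ℂ v) p
      = ∏ i, inner ℂ (stdOrthonormalBasis ℂ H (p i)) (v i) := by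
  refine (Basis.piTensorProduct_repr_tprod_apply (R := ℂ) (M := fun _ : Fin n => H)
    (fun _ => (stdOrthonormalBasis ℂ H).toBasis) v p).trans ?_
  simp [OrthonormalBasis.repr_apply_apply]

/-- `⟨v₁ ⊗ ⋯ ⊗ vₙ, w₁ ⊗ ⋯ ⊗ wₙ⟩ = ∏ ⟨vᵢ, wᵢ⟩`. -/
theorem inner_elemTensor {n : ℕ} (v w : Fin n → H) :
    inner ℂ (elemTensor v) (elemTensor w) = ∏ i, inner ℂ (v i) (w i) := by
  change ∑ p, conj ((tensorPowBasis H n).repr (PiTensorProduct.tprod ℂ v) p)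
    * (tensorPowBasis H n).repr (PiTensorProduct.tprod ℂ w) p = _
  simp_rw [tensorPowBasis_repr_tprod, map_prod, ← Finset.prod_mul_distrib, inner_conj_symm]
  rw [← Fintype.piFinset_univ, ← Finset.prod_univ_sum
    (fun _ => (Finset.univ : Finset (Fin (Module.finrank ℂ H))))
    (fun i j => inner ℂ (v i) (stdOrthonormalBasis ℂ H j)
      * inner ℂ (stdOrthonormalBasis ℂ H j) (w i))]
  exact Finset.prod_congr rfl fun i _ =>
    (stdOrthonormalBasis ℂ H).sum_inner_mul_inner (v i) (w i)

end TensorPower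

section Bosons

variable {H : Type*} [NormedAddCommGroup H] [InnerProductSpace ℂ H] [FiniteDimensional ℂ H]

/-- The action of a permutation on `H^{⊗n}`: the factor number `i` is moved to position `σ i`. -/
def permTensor {n : ℕ} (σ : Equiv.Perm (Fin n)) : TensorPow H n ≃ₗ[ℂ] TensorPow H n :=
  (TensorPow.equivPi H n).trans
    ((PiTensorProduct.reindex ℂ (fun _ => H) σ).trans (TensorPow.equivPi H n).symm)

variable (H) in
/-- The bosonic space `H_s^n`: the tensors that are invariant under all permutations. -/
def bosonSpace (n : ℕ) : Submodule ℂ (TensorPow H n) where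
  carrier := {ψ | ∀ σ : Equiv.Perm (Fin n), permTensor σ ψ = ψ}
  add_mem' ha hb σ := by rw [map_add, ha σ, hb σ]
  zero_mem' σ := map_zero _
  smul_mem' c x hx σ := by rw [map_smul, hx σ]

/-- The vector `u^{⊗n}` of `H_s^n`. -/
def bosonPow (n : ℕ) (u : H) : bosonSpace H n :=
  ⟨elemTensor fun _ => u, fun σ =>
    PiTensorProduct.reindex_tprod (R := ℂ) (s := fun _ : Fin n => H) σ fun _ => u⟩

/-- The isomorphism `H^{⊗k} ⊗ H^{⊗m} ≃ H^{⊗n}` which puts the `k` factors on the left at the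
positions `e (inl i)` and the `m` factors on the right at the positions `e (inr j)`. -/
def splitTensor {k m n : ℕ} (e : Fin k ⊕ Fin m ≃ Fin n) :
    TensorPow H k ⊗[ℂ] TensorPow H m ≃ₗ[ℂ] TensorPow H n :=
  (TensorProduct.congr (TensorPow.equivPi H k) (TensorPow.equivPi H m)).trans
    ((PiTensorProduct.tmulEquiv ℂ H).trans
      ((PiTensorProduct.reindex ℂ (fun _ => H) e).trans (TensorPow.equivPi H n).symm))

theorem splitTensor_tmul {k m n : ℕ} (e : Fin k ⊕ Fin m ≃ Fin n) (v : Fin k → H)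
    (w : Fin m → H) :
    splitTensor e (elemTensor v ⊗ₜ[ℂ] elemTensor w)
      = elemTensor fun i => Sum.elim v w (e.symm i) := by
  change PiTensorProduct.reindex ℂ (fun _ => H) e (PiTensorProduct.tmulEquiv ℂ H
    (PiTensorProduct.tprod ℂ v ⊗ₜ[ℂ] PiTensorProduct.tprod ℂ w)) = _
  rw [PiTensorProduct.tmulEquiv_apply]
  exact PiTensorProduct.reindex_tprod e _

/-- For `k ≤ n`, the splitting of `n` positions into the first `k` and the last `n - k`. -/
def firstLast {k n : ℕ} (h : k ≤ n) : Fin k ⊕ Fin (n - k) ≃ Fin n :=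
  finSumFinEquiv.trans (finCongr (Nat.add_sub_cancel' h))

/-- The operator on `H^{⊗n}` in which `A` acts on the variables `e (inl 1), …, e (inl k)` and
`B` on the variables `e (inr 1), …, e (inr m)`. -/
def actOn {k m n : ℕ} (e : Fin k ⊕ Fin m ≃ Fin n) (A : Module.End ℂ (TensorPow H k))
    (B : Module.End ℂ (TensorPow H m)) : Module.End ℂ (TensorPow H n) :=
  (splitTensor e).conj (TensorProduct.map A B)

/-- `A ⊗_s B = 1 / (k! (n-k)!) ∑_{σ ∈ S_n} A_{σ(1),…,σ(k)} ⊗ B_{σ(k+1),…,σ(n)}`. -/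
def symTensor {k n : ℕ} (h : k ≤ n) (A : Module.End ℂ (TensorPow H k))
    (B : Module.End ℂ (TensorPow H (n - k))) : Module.End ℂ (TensorPow H n) :=
  ((k.factorial * (n - k).factorial : ℕ) : ℂ)⁻¹ •
    ∑ σ : Equiv.Perm (Fin n), actOn ((firstLast h).trans σ) A B

/-- The partial trace over the second factor: `A ⊗ B ↦ tr(B) A`. -/
def partialTraceRight (V W : Type*) [AddCommGroup V] [Module ℂ V] [FiniteDimensional ℂ V]
    [AddCommGroup W] [Module ℂ W] [FiniteDimensional ℂ W] :
    Module.End ℂ (V ⊗[ℂ] W) →ₗ[ℂ] Module.End ℂ V :=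
  (TensorProduct.rid ℂ (Module.End ℂ V)).toLinearMap ∘ₗ
    LinearMap.lTensor (Module.End ℂ V) (LinearMap.trace ℂ W) ∘ₗ
    (homTensorHomEquiv ℂ V W V W).symm.toLinearMap

theorem partialTraceRight_map {V W : Type*} [AddCommGroup V] [Module ℂ V]
    [FiniteDimensional ℂ V] [AddCommGroup W] [Module ℂ W] [FiniteDimensional ℂ W]
    (A : Module.End ℂ V) (B : Module.End ℂ W) :
    partialTraceRight V W (TensorProduct.map A B) = LinearMap.trace ℂ W B • A := by
  have h : (homTensorHomEquiv ℂ V W V W).symm (TensorProduct.map A B) = A ⊗ₜ[ℂ] B := by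
    rw [LinearEquiv.symm_apply_eq, homTensorHomEquiv_apply, TensorProduct.homTensorHomMap_apply]
  change TensorProduct.rid ℂ (Module.End ℂ V) (LinearMap.lTensor (Module.End ℂ V)
    (LinearMap.trace ℂ W) ((homTensorHomEquiv ℂ V W V W).symm (TensorProduct.map A B))) = _
  rw [h, LinearMap.lTensor_tmul, TensorProduct.rid_tmul]

/-- The partial trace `tr_{n+1 → N}` over the last `N - n` particles. -/
def partialTrace {n N : ℕ} (h : n ≤ N) (T : Module.End ℂ (TensorPow H N)) :
    Module.End ℂ (TensorPow H n) :=
  partialTraceRight (TensorPow H n) (TensorPow H (N - n)) ((splitTensor (firstLast h)).symm.conj T)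

/-- The duality that characterizes the partial trace:
`tr[A · tr_{n+1 → N} T] = tr[(A ⊗ 1) T]`. -/
theorem trace_mul_partialTrace {n N : ℕ} (h : n ≤ N) (A : Module.End ℂ (TensorPow H n))
    (T : Module.End ℂ (TensorPow H N)) :
    LinearMap.trace ℂ _ (A * partialTrace h T)
      = LinearMap.trace ℂ _ (actOn (firstLast h) A 1 * T) := by
  have hT : actOn (firstLast h) A (1 : Module.End ℂ (TensorPow H (N - n))) * T =
      (splitTensor (H := H) (firstLast h)).conj (TensorProduct.map A 1 * (splitTensor (firstLast h)).symm.conj T) := by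
    ext x
    simp [actOn, LinearEquiv.conj_apply]
  rw [hT, LinearMap.trace_conj', partialTrace]
  generalize (splitTensor (firstLast h)).symm.conj T = S
  obtain ⟨S, rfl⟩ := (homTensorHomEquiv ℂ (TensorPow H n) (TensorPow H (N - n))
    (TensorPow H n) (TensorPow H (N - n))).surjective S
  induction S with
  | zero => simp
  | add x y hx hy => simp only [map_add, mul_add, hx, hy]
  | tmul B C =>
    rw [homTensorHomEquiv_apply, TensorProduct.homTensorHomMap_apply, partialTraceRight_map,
      ← TensorProduct.map_mul, LinearMap.trace_tensorProduct', one_mul, mul_smul_comm, map_smul,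
      smul_eq_mul, mul_comm]

/-- A bosonic state: a positive self-adjoint operator on `H_s^N` with trace one. -/
structure IsBosonicState {N : ℕ} (Γ : bosonSpace H N →L[ℂ] bosonSpace H N) : Prop where
  isPositive : Γ.IsPositive
  trace_eq_one : LinearMap.trace ℂ (bosonSpace H N) Γ.toLinearMap = 1

/-- An operator on `H_s^N`, seen as an operator on `H^{⊗N}` that vanishes on the orthogonal
complement of `H_s^N`. -/
def extendByZero {N : ℕ} (Γ : bosonSpace H N →L[ℂ] bosonSpace H N) :
    Module.End ℂ (TensorPow H N) :=
  (bosonSpace H N).subtype ∘ₗ Γ.toLinearMap ∘ₗ (bosonSpace H N).orthogonalProjectionOnto.toLinearMap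

/-- The `n`-th reduced density matrix `γ^{(n)} = tr_{n+1 → N} Γ`. -/
def reducedDensity {n N : ℕ} (h : n ≤ N) (Γ : bosonSpace H N →L[ℂ] bosonSpace H N) :
    Module.End ℂ (TensorPow H n) :=
  partialTrace h (extendByZero Γ)

theorem continuous_bosonPow (N : ℕ) : Continuous fun u : H => bosonPow N u := by
  refine Continuous.subtype_mk ?_ _
  have h : ∀ u : H, elemTensor (fun _ : Fin N => u)
      = ∑ p : Fin N → Fin (Module.finrank ℂ H),
        (∏ i, inner ℂ (stdOrthonormalBasis ℂ H (p i)) u) •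
          (TensorPow.equivPi H N).symm (tensorPowBasis H N p) := by
    intro u
    have h1 := (tensorPowBasis H N).sum_repr (PiTensorProduct.tprod ℂ fun _ => u)
    simp_rw [tensorPowBasis_repr_tprod] at h1
    simp_rw [← map_smul, ← map_sum, h1]
    rfl
  simp_rw [h]
  fun_prop

variable [MeasurableSpace H] [BorelSpace H]

variable (H) in
/-- The uniform probability measure `du` on the unit sphere of `H`: the normalized surface
measure (for `H ≠ 0`). -/
def uniformSphere : MeasureTheory.Measure (Metric.sphere (0 : H) 1) :=
  haveI : ProperSpace H := FiniteDimensional.proper_rclike ℂ H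
  let ν := (MeasureTheory.Measure.addHaar : MeasureTheory.Measure H).toSphere
  (ν Set.univ)⁻¹ • ν

instance [Nontrivial H] : MeasureTheory.IsProbabilityMeasure (uniformSphere H) := by
  have : ProperSpace H := FiniteDimensional.proper_rclike ℂ H
  refine ⟨?_⟩
  simp only [uniformSphere, MeasureTheory.Measure.smul_apply, smul_eq_mul]
  refine ENNReal.inv_mul_cancel ?_ (MeasureTheory.measure_ne_top _ _)
  rw [Ne, MeasureTheory.Measure.measure_univ_eq_zero]
  exact MeasureTheory.Measure.toSphere_ne_zero _

/-- The state
`Γ̃ = dim(H_s^N) ∫ |u^{⊗N}⟩⟨u^{⊗N}| ⟨u^{⊗N}, Γ u^{⊗N}⟩ du`. -/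
def ckmrState {N : ℕ} (Γ : bosonSpace H N →L[ℂ] bosonSpace H N) :
    bosonSpace H N →L[ℂ] bosonSpace H N :=
  (Module.finrank ℂ (bosonSpace H N) : ℂ) •
    ∫ u : Metric.sphere (0 : H) 1,
      inner ℂ (bosonPow N (u : H)) (Γ (bosonPow N (u : H))) •
        InnerProductSpace.rankOne ℂ (bosonPow N (u : H)) (bosonPow N (u : H)) ∂(uniformSphere H)

/-- The integral in `ckmrState` converges. -/
theorem integrable_ckmr {N : ℕ} [Nontrivial H] (Γ : bosonSpace H N →L[ℂ] bosonSpace H N) :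
    MeasureTheory.Integrable (fun u : Metric.sphere (0 : H) 1 =>
      inner ℂ (bosonPow N (u : H)) (Γ (bosonPow N (u : H))) •
        InnerProductSpace.rankOne ℂ (bosonPow N (u : H)) (bosonPow N (u : H)))
      (uniformSphere H) := by
  have : ProperSpace H := FiniteDimensional.proper_rclike ℂ H
  have hc : Continuous fun u : Metric.sphere (0 : H) 1 => bosonPow N (u : H) :=
    (continuous_bosonPow N).comp continuous_subtype_val
  have hr : Continuous fun u : Metric.sphere (0 : H) 1 =>
      InnerProductSpace.rankOne ℂ (bosonPow N (u : H)) (bosonPow N (u : H)) :=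
    ((ContinuousLinearMap.smulRightL ℂ _ _).continuous.comp
      ((innerSL ℂ).continuous.comp hc)).clm_apply hc
  refine Continuous.integrable_of_hasCompactSupport ?_ (HasCompactSupport.of_compactSpace _)
  exact (Continuous.inner (𝕜 := ℂ) hc (Γ.continuous.comp hc)).smul hr

end Bosons

end

open scoped TensorProduct ComplexConjugate

noncomputable section

/-! ### Moments of the uniform measure on the unit sphere -/

section Sphere

open MeasureTheory Metric
open scoped Pointwise

variable {H : Type*} [NormedAddCommGroup H] [InnerProductSpace ℂ H] [FiniteDimensional ℂ H]

/-! Both sides are linear in Γ. Since the vectors u^{⊗n} span H_s^n (`span_bosonPow`, by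
polarization), it suffices to take Γ = |a^{⊗N}⟩⟨b^{⊗N}| and to compare matrix elements between
w^{⊗n} and v^{⊗n}. The left side becomes dim(H_s^N) times ∫ ⟨b,u⟩^N ⟨w,u⟩^n ⟨u,a⟩^N ⟨u,v⟩^n du.

With K = N + n, this integral is a matrix element of ∫ |u^{⊗K}⟩⟨u^{⊗K}| du, which is a multiple c_K
of the identity on H_s^K. Instead of Schur's lemma, invariance under phase rotations about a unit
vector gives ∫ ⟨b,u⟩^K ⟨u,a⟩^K du = c_K ⟨b,a⟩^K (`integral_inner_pow`). Replacing a by tv + a and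
then b by b + t̄w and comparing coefficients of t^n yields the mixed moments
(`integral_inner_pow_mul_pow_mul`). The index ℓ of Chiribella's sum counts the copies of w that are
paired with a.

The constants come from (k + d) c_{k+1} = (k + 1) c_k (`sphereMoment_succ`) and from dim(H_s^N) c_N
= 1, obtained by taking a trace. -/

theorem addHaar_image_linearIsometryEquiv [MeasurableSpace H] [BorelSpace H]
    (U : H ≃ₗᵢ[ℂ] H) (s : Set H) :
    haveI : ProperSpace H := FiniteDimensional.proper_rclike ℂ H
    (Measure.addHaar : Measure H) (U '' s) = Measure.addHaar s := by
  have : ProperSpace H := FiniteDimensional.proper_rclike ℂ H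
  have : FiniteDimensional ℝ H := FiniteDimensional.complexToReal H
  set f : H →ₗ[ℝ] H := (U.toLinearEquiv.toLinearMap).restrictScalars ℝ
  have hf (s : Set H) : (Measure.addHaar : Measure H) (U '' s)
      = ENNReal.ofReal |LinearMap.det f| * Measure.addHaar s :=
    Measure.addHaar_image_linearMap _ f s
  -- The scaling factor |det| is found by testing on the unit ball, which U preserves and whose
  -- measure is positive and finite.
  have hb := hf (ball 0 1)
  rw [U.image_ball, map_zero] at hb
  have h0 : (Measure.addHaar : Measure H) (ball 0 1) ≠ 0 :=
    (measure_ball_pos _ _ one_pos).ne'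
  have h1 : (Measure.addHaar : Measure H) (ball 0 1) ≠ ⊤ := measure_ball_lt_top.ne
  have h2 : ENNReal.ofReal |LinearMap.det f| = 1 := by
    nth_rewrite 1 [← one_mul ((Measure.addHaar : Measure H) (ball 0 1))] at hb
    exact ((ENNReal.mul_left_inj h0 h1).1 hb).symm
  rw [hf, h2, one_mul]

/-- The action of a unitary on the unit sphere. -/
def sphereMap (U : H ≃ₗᵢ[ℂ] H) (u : sphere (0 : H) 1) : sphere (0 : H) 1 :=
  ⟨U u, by simp⟩

omit [FiniteDimensional ℂ H] in
theorem continuous_sphereMap (U : H ≃ₗᵢ[ℂ] H) : Continuous (sphereMap U) :=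
  (U.continuous.comp continuous_subtype_val).subtype_mk _

/-- The unitary that multiplies the unit vector `e` by the phase `ζ` and fixes its orthogonal
complement. -/
def phaseUnitary (e : H) (he : ‖e‖ = 1) (ζ : ℂ) (hζ : ‖ζ‖ = 1) : H ≃ₗᵢ[ℂ] H :=
  LinearIsometry.toLinearIsometryEquiv
    (LinearMap.isometryOfInner
      (LinearMap.id + (ζ - 1) • (InnerProductSpace.rankOne ℂ e e).toLinearMap) fun x y => by
        have h1 : conj ζ * ζ = 1 := by rw [RCLike.conj_mul, hζ]; simp
        have h2 : inner ℂ e e = (1 : ℂ) := by rw [inner_self_eq_norm_sq_to_K, he]; simp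
        have h3 : inner ℂ x e = conj (inner ℂ e x) := (inner_conj_symm _ _).symm
        simp only [LinearMap.add_apply, LinearMap.id_apply, LinearMap.smul_apply,
          ContinuousLinearMap.coe_coe, InnerProductSpace.rankOne_apply, inner_add_left,
          inner_add_right, inner_smul_left, inner_smul_right, h2, map_sub, map_one, h3]
        -- The extra terms have total coefficient (ζ - 1) + (ζ̄ - 1) + |ζ - 1|² = |ζ|² - 1 = 0.
        linear_combination (conj (inner ℂ e x) * inner ℂ e y) * h1) rfl

theorem phaseUnitary_apply (e : H) (he : ‖e‖ = 1) (ζ : ℂ) (hζ : ‖ζ‖ = 1) (x : H) :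
    phaseUnitary e he ζ hζ x = x + (ζ - 1) • inner ℂ e x • e := rfl

theorem inner_phaseUnitary_self (e : H) (he : ‖e‖ = 1) (ζ : ℂ) (hζ : ‖ζ‖ = 1) (x : H) :
    inner ℂ e (phaseUnitary e he ζ hζ x) = ζ * inner ℂ e x := by
  have h2 : inner ℂ e e = (1 : ℂ) := by rw [inner_self_eq_norm_sq_to_K, he]; simp
  simp only [phaseUnitary_apply, inner_add_right, inner_smul_right, h2]
  ring

theorem inner_phaseUnitary_of_orthogonal (e : H) (he : ‖e‖ = 1) (ζ : ℂ) (hζ : ‖ζ‖ = 1) (x c : H)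
    (hc : inner ℂ e c = (0 : ℂ)) :
    inner ℂ (phaseUnitary e he ζ hζ x) c = inner ℂ x c := by
  simp [phaseUnitary_apply, hc]

variable [MeasurableSpace H] [BorelSpace H]

/-- The surface measure of s is, up to a dimensional factor, the Haar volume of the cone (0,1) • s,
and forming cones commutes with the linear isometry U. -/
theorem measurePreserving_sphereMap (U : H ≃ₗᵢ[ℂ] H) :
    MeasurePreserving (sphereMap U) (uniformSphere H) (uniformSphere H) := by
  have : ProperSpace H := FiniteDimensional.proper_rclike ℂ H
  have hm : Measurable (sphereMap U) := (continuous_sphereMap U).measurable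
  suffices h : MeasurePreserving (sphereMap U) ((Measure.addHaar : Measure H).toSphere)
      ((Measure.addHaar : Measure H).toSphere) from h.smul_measure _
  refine ⟨hm, Measure.ext fun s hs => ?_⟩
  rw [Measure.map_apply hm hs, Measure.toSphere_apply' _ hs, Measure.toSphere_apply' _ (hm hs)]
  congr 1
  have h1 : ((↑) '' (sphereMap U ⁻¹' s) : Set H) = U.symm '' ((↑) '' s) := by
    ext x
    constructor
    · rintro ⟨u, hu, rfl⟩
      exact ⟨U u, ⟨_, hu, rfl⟩, by simp⟩
    · rintro ⟨_, ⟨u, hu, rfl⟩, rfl⟩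
      refine ⟨⟨U.symm u, by simp⟩, ?_, rfl⟩
      have : sphereMap U ⟨U.symm u, by simp⟩ = u := Subtype.ext (by simp [sphereMap])
      rwa [Set.mem_preimage, this]
  have h2 : Set.Ioo (0 : ℝ) 1 • (U.symm '' ((↑) '' s : Set H))
      = U.symm '' (Set.Ioo (0 : ℝ) 1 • ((↑) '' s : Set H)) := by
    ext x
    simp only [Set.mem_smul, Set.mem_image]
    constructor
    · rintro ⟨r, hr, _, ⟨y, hy, rfl⟩, rfl⟩
      exact ⟨r • y, ⟨r, hr, y, hy, rfl⟩,
        (U.symm.toLinearEquiv.toLinearMap.restrictScalars ℝ).map_smul r y⟩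
    · rintro ⟨_, ⟨r, hr, y, hy, rfl⟩, rfl⟩
      exact ⟨r, hr, _, ⟨y, hy, rfl⟩,
        ((U.symm.toLinearEquiv.toLinearMap.restrictScalars ℝ).map_smul r y).symm⟩
  rw [h1, h2, addHaar_image_linearIsometryEquiv]

theorem integral_sphereMap (U : H ≃ₗᵢ[ℂ] H) {f : sphere (0 : H) 1 → ℂ} (hf : Continuous f) :
    ∫ u, f (sphereMap U u) ∂(uniformSphere H) = ∫ u, f u ∂(uniformSphere H) := by
  have h := measurePreserving_sphereMap U
  rw [← integral_map h.measurable.aemeasurable hf.aestronglyMeasurable, h.map_eq]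

/-- Continuous functions on the sphere are integrable. -/
theorem integrable_sphere {f : sphere (0 : H) 1 → ℂ} [Nontrivial H] (hf : Continuous f) :
    Integrable f (uniformSphere H) := by
  have : ProperSpace H := FiniteDimensional.proper_rclike ℂ H
  exact hf.integrable_of_hasCompactSupport (HasCompactSupport.of_compactSpace _)

/-- The moments of `inner e u` for a unit vector `e`. -/
theorem integral_inner_pow_of_unit [Nontrivial H] (K : ℕ) (e a : H) (he : ‖e‖ = 1) :
    ∫ u : sphere (0 : H) 1, inner ℂ e (u : H) ^ K * inner ℂ (u : H) a ^ K ∂(uniformSphere H)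
      = inner ℂ e a ^ K *
        ∫ u : sphere (0 : H) 1, inner ℂ e (u : H) ^ K * inner ℂ (u : H) e ^ K
          ∂(uniformSphere H) := by
  have hee : inner ℂ e e = (1 : ℂ) := by rw [inner_self_eq_norm_sq_to_K, he]; simp
  set α : ℂ := inner ℂ e a with hα
  -- Split a into its components along e and orthogonal to e. In the binomial expansion of ⟨u,a⟩^K
  -- only the term without c will survive.
  set c : H := a - α • e with hc
  have hec : inner ℂ e c = (0 : ℂ) := by
    rw [hc, inner_sub_right, inner_smul_right, hee, ← hα]; ring
  have ha (u : H) : inner ℂ u a = inner ℂ u c + α * inner ℂ u e := by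
    rw [hc, inner_sub_right, inner_smul_right]; ring
  have hG (j i : ℕ) (hj : j ≠ 0) (hij : i + j = K) :
      ∫ u : sphere (0 : H) 1, inner ℂ e (u : H) ^ K * (inner ℂ (u : H) c ^ j * inner ℂ (u : H) e ^ i)
        ∂(uniformSphere H) = 0 := by
    -- Rotating the e-component of u by ζ multiplies the integrand by ζ^K ζ̄^i = ζ^j. The choice ζ^j
    -- = -1 makes the integral equal to its own negative.
    set ζ : ℂ := Complex.exp ((Real.pi / j : ℝ) * Complex.I) with hζd
    have hζ : ‖ζ‖ = 1 := Complex.norm_exp_ofReal_mul_I _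
    have hζj : ζ ^ j = -1 := by
      rw [hζd, ← Complex.exp_nat_mul, ← Complex.exp_pi_mul_I]
      congr 1
      have : (j : ℂ) ≠ 0 := Nat.cast_ne_zero.2 hj
      push_cast
      field_simp
    have h1 : ζ * conj ζ = 1 := by rw [mul_comm, RCLike.conj_mul, hζ]; simp
    have hf : Continuous fun u : sphere (0 : H) 1 =>
        (inner ℂ e (u : H) ^ K * (inner ℂ (u : H) c ^ j * inner ℂ (u : H) e ^ i) : ℂ) := by fun_prop
    have h := integral_sphereMap (phaseUnitary e he ζ hζ) hf
    have h2 : ∀ u : sphere (0 : H) 1, ((inner ℂ e (sphereMap (phaseUnitary e he ζ hζ) u : H) ^ K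
        * (inner ℂ (sphereMap (phaseUnitary e he ζ hζ) u : H) c ^ j
        * inner ℂ (sphereMap (phaseUnitary e he ζ hζ) u : H) e ^ i) : ℂ))
        = -(inner ℂ e (u : H) ^ K * (inner ℂ (u : H) c ^ j * inner ℂ (u : H) e ^ i)) := by
      intro u
      change inner ℂ e (phaseUnitary e he ζ hζ u) ^ K * (inner ℂ (phaseUnitary e he ζ hζ u) c ^ j
        * inner ℂ (phaseUnitary e he ζ hζ u) e ^ i) = _
      rw [inner_phaseUnitary_of_orthogonal _ _ _ _ _ _ hec,
        ← inner_conj_symm (phaseUnitary e he ζ hζ u) e, inner_phaseUnitary_self, map_mul,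
        inner_conj_symm, mul_pow, mul_pow, ← hij, pow_add ζ, hζj]
      have h3 : ζ ^ i * conj ζ ^ i = 1 := by rw [← mul_pow, h1, one_pow]
      linear_combination (-(inner ℂ e (u : H) ^ (i + j) * (inner ℂ (u : H) c ^ j
        * inner ℂ (u : H) e ^ i))) * h3
    simp_rw [h2] at h
    rw [integral_neg] at h
    exact self_eq_neg.1 h.symm
  simp_rw [ha, add_pow, Finset.mul_sum]
  rw [integral_finsetSum]
  · rw [Finset.sum_eq_single 0]
    · rw [← integral_const_mul]
      refine integral_congr_ae (.of_forall fun u => ?_)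
      simp [mul_pow]
      ring
    · intro j hj hj0
      rw [← mul_zero (α ^ (K - j) * (K.choose j : ℂ)),
        ← hG j (K - j) hj0 (Nat.sub_add_cancel (Finset.mem_range_succ_iff.1 hj)),
        ← integral_const_mul]
      refine integral_congr_ae (.of_forall fun u => ?_)
      simp [mul_pow]
      ring
    · simp
  · intro j _
    exact integrable_sphere (by fun_prop)

variable (H) in
/-- The moment `∫ |⟨e, u⟩|^{2K} du` for a unit vector `e`. -/
def sphereMoment [Nontrivial H] (K : ℕ) : ℂ :=
  ∫ u : sphere (0 : H) 1, inner ℂ (exists_norm_eq H zero_le_one).choose (u : H) ^ K *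
    inner ℂ (u : H) (exists_norm_eq H zero_le_one).choose ^ K ∂(uniformSphere H)

/-- The integral of ⟨e,u⟩^K ⟨u,f⟩^K can be evaluated by splitting f along e or, after conjugation, e
along f. Both answers carry the factor ⟨e,f⟩^K, which cancels. -/
theorem integral_inner_pow_unit_congr [Nontrivial H] (K : ℕ) {e f : H} (he : ‖e‖ = 1)
    (hf : ‖f‖ = 1) (hef : inner ℂ e f ≠ (0 : ℂ)) :
    ∫ u : sphere (0 : H) 1, inner ℂ e (u : H) ^ K * inner ℂ (u : H) e ^ K ∂(uniformSphere H)
      = ∫ u : sphere (0 : H) 1, inner ℂ f (u : H) ^ K * inner ℂ (u : H) f ^ K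
          ∂(uniformSphere H) := by
  have h1 := integral_inner_pow_of_unit K e f he
  have h2 := congrArg conj (integral_inner_pow_of_unit K f e hf)
  rw [← integral_conj, map_mul, ← integral_conj] at h2
  simp only [map_mul, map_pow, inner_conj_symm] at h2
  refine mul_left_cancel₀ (pow_ne_zero K hef) (h1.symm.trans ?_)
  simpa only [mul_comm (inner ℂ _ f ^ K)] using h2

/-- If e is orthogonal to the reference vector f, the normalized e + f is orthogonal to neither and
serves as an intermediate step. -/
theorem integral_inner_pow_unit_self [Nontrivial H] (K : ℕ) {e : H} (he : ‖e‖ = 1) :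
    ∫ u : sphere (0 : H) 1, inner ℂ e (u : H) ^ K * inner ℂ (u : H) e ^ K ∂(uniformSphere H)
      = sphereMoment H K := by
  set f : H := (exists_norm_eq H zero_le_one).choose with hfd
  have hf : ‖f‖ = 1 := (exists_norm_eq H zero_le_one).choose_spec
  by_cases hef : inner ℂ e f = (0 : ℂ)
  · have hfe : inner ℂ f e = (0 : ℂ) := by rw [← inner_conj_symm, hef, map_zero]
    have hee : inner ℂ e e = (1 : ℂ) := by rw [inner_self_eq_norm_sq_to_K, he]; simp
    have hff : inner ℂ f f = (1 : ℂ) := by rw [inner_self_eq_norm_sq_to_K, hf]; simp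
    have h0 : e + f ≠ 0 := by
      intro h
      have h1 : inner ℂ e (e + f) = (0 : ℂ) := by rw [h, inner_zero_right]
      rw [inner_add_right, hee, hef] at h1
      norm_num at h1
    have hn : ((‖e + f‖⁻¹ : ℝ) : ℂ) ≠ 0 := by
      exact_mod_cast inv_ne_zero (norm_ne_zero_iff.2 h0)
    have hg : ‖((‖e + f‖⁻¹ : ℝ) : ℂ) • (e + f)‖ = 1 := by
      rw [norm_smul, Complex.norm_real, norm_inv, norm_norm,
        inv_mul_cancel₀ (norm_ne_zero_iff.2 h0)]
    refine (integral_inner_pow_unit_congr K he hg ?_).trans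
      (integral_inner_pow_unit_congr K hg hf ?_)
    · rw [inner_smul_right, inner_add_right, hee, hef, add_zero, mul_one]
      exact hn
    · rw [inner_smul_left, inner_add_left, hff, hef, zero_add, mul_one, Complex.conj_ofReal]
      exact hn
  · exact integral_inner_pow_unit_congr K he hf hef

theorem sphereMoment_zero [Nontrivial H] : sphereMoment H 0 = 1 := by
  simp [sphereMoment]

/-- `⟨b^{⊗K}, (∫ |u^{⊗K}⟩⟨u^{⊗K}| du) a^{⊗K}⟩` is a multiple of `⟨b^{⊗K}, a^{⊗K}⟩`. -/
theorem integral_inner_pow [Nontrivial H] (K : ℕ) (b a : H) :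
    ∫ u : sphere (0 : H) 1, inner ℂ b (u : H) ^ K * inner ℂ (u : H) a ^ K ∂(uniformSphere H)
      = inner ℂ b a ^ K * sphereMoment H K := by
  by_cases hb : b = 0
  · subst hb
    rcases Nat.eq_zero_or_pos K with rfl | hK
    · simp [sphereMoment_zero]
    · simp [hK.ne']
  · have hn : ‖b‖ ≠ 0 := norm_ne_zero_iff.2 hb
    set e : H := ((‖b‖⁻¹ : ℝ) : ℂ) • b with he
    have he1 : ‖e‖ = 1 := by
      rw [he, norm_smul, Complex.norm_real, norm_inv, norm_norm, inv_mul_cancel₀ hn]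
    have hbe : b = (‖b‖ : ℂ) • e := by
      rw [he, smul_smul, ← Complex.ofReal_mul, mul_inv_cancel₀ hn, Complex.ofReal_one, one_smul]
    rw [hbe]
    simp_rw [inner_smul_left, Complex.conj_ofReal, mul_pow, mul_assoc]
    rw [integral_const_mul, integral_inner_pow_of_unit K e a he1,
      integral_inner_pow_unit_self K he1]

/-- Polynomial functions that agree have the same coefficients. -/
theorem coeff_eq_of_forall_sum_eq {K : ℕ} {c d : ℕ → ℂ}
    (h : ∀ t : ℂ, ∑ j ∈ Finset.range (K + 1), t ^ j * c j
      = ∑ j ∈ Finset.range (K + 1), t ^ j * d j) {n : ℕ} (hn : n ≤ K) : c n = d n := by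
  have h1 : ∑ j ∈ Finset.range (K + 1), Polynomial.monomial j (c j)
      = ∑ j ∈ Finset.range (K + 1), Polynomial.monomial j (d j) := by
    refine Polynomial.funext fun t => ?_
    simpa [Polynomial.eval_finsetSum, mul_comm] using h t
  have h2 := congrArg (fun p => Polynomial.coeff p n) h1
  have h3 : n < K + 1 := Nat.lt_succ_of_le hn
  simpa [Polynomial.finsetSum_coeff, Polynomial.coeff_monomial, h3] using h2

/-- Polarization in the second argument: `integral_inner_pow` at tv + a is a polynomial identity in
t, and the coefficients of t^n carry the same binomial factor on both sides. -/
theorem integral_inner_pow_mul [Nontrivial H] (N n : ℕ) (b a v : H) :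
    ∫ u : sphere (0 : H) 1, inner ℂ b (u : H) ^ (N + n) *
        (inner ℂ (u : H) a ^ N * inner ℂ (u : H) v ^ n) ∂(uniformSphere H)
      = inner ℂ b a ^ N * inner ℂ b v ^ n * sphereMoment H (N + n) := by
  set G : ℕ → ℂ := fun j => ∫ u : sphere (0 : H) 1, inner ℂ b (u : H) ^ (N + n) *
    (inner ℂ (u : H) v ^ j * inner ℂ (u : H) a ^ (N + n - j)) ∂(uniformSphere H) with hG
  have key : ∀ t : ℂ, ∑ j ∈ Finset.range (N + n + 1), t ^ j * (((N + n).choose j : ℂ) * G j)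
      = ∑ j ∈ Finset.range (N + n + 1), t ^ j * (((N + n).choose j : ℂ) *
        (inner ℂ b v ^ j * inner ℂ b a ^ (N + n - j) * sphereMoment H (N + n))) := by
    intro t
    have h := integral_inner_pow (N + n) b (t • v + a)
    simp_rw [inner_add_right, inner_smul_right, add_pow, Finset.mul_sum] at h
    rw [integral_finsetSum _ fun j _ => integrable_sphere (by fun_prop), Finset.sum_mul] at h
    convert h using 1
    · refine Finset.sum_congr rfl fun j _ => ?_
      rw [hG, ← mul_assoc, ← integral_const_mul]
      refine integral_congr_ae (.of_forall fun u => ?_)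
      simp only [mul_pow]
      ring
    · refine Finset.sum_congr rfl fun j _ => ?_
      rw [mul_pow]
      ring
  have h := coeff_eq_of_forall_sum_eq key (Nat.le_add_left n N)
  have h0 : ((N + n).choose n : ℂ) ≠ 0 :=
    Nat.cast_ne_zero.2 (Nat.choose_pos (Nat.le_add_left n N)).ne'
  have h1 := mul_left_cancel₀ h0 h
  simp only [hG, Nat.add_sub_cancel] at h1
  simp_rw [mul_comm (inner ℂ _ a ^ N)]
  rw [h1]

/-- The mixed moments `⟨b^{⊗N} ⊗ w^{⊗n}, (∫ |u^{⊗(N+n)}⟩⟨u^{⊗(N+n)}| du) a^{⊗N} ⊗ v^{⊗n}⟩`. -/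
theorem integral_inner_pow_mul_pow_mul [Nontrivial H] (N n : ℕ) (b w a v : H) :
    ((N + n).choose n : ℂ) *
      ∫ u : sphere (0 : H) 1, inner ℂ b (u : H) ^ N * inner ℂ w (u : H) ^ n *
        (inner ℂ (u : H) a ^ N * inner ℂ (u : H) v ^ n) ∂(uniformSphere H)
      = sphereMoment H (N + n) * ∑ l ∈ Finset.range (n + 1), (N.choose l : ℂ) * (n.choose l : ℂ) *
          (inner ℂ w a ^ l * inner ℂ b a ^ (N - l) *
            (inner ℂ w v ^ (n - l) * inner ℂ b v ^ l)) := by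
  set G : ℕ → ℂ := fun j => ∫ u : sphere (0 : H) 1,
    inner ℂ w (u : H) ^ j * inner ℂ b (u : H) ^ (N + n - j) *
    (inner ℂ (u : H) a ^ N * inner ℂ (u : H) v ^ n) ∂(uniformSphere H) with hG
  set P : ℂ → ℂ → Polynomial ℂ := fun x y => Polynomial.C x * Polynomial.X + Polynomial.C y
    with hP
  set Q : Polynomial ℂ := P (inner ℂ w a) (inner ℂ b a) ^ N * P (inner ℂ w v) (inner ℂ b v) ^ n
    with hQ
  have hPd (x y : ℂ) (k : ℕ) : (P x y ^ k).natDegree ≤ k := by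
    refine Polynomial.natDegree_pow_le_of_le k Polynomial.natDegree_linear_le |>.trans (by simp)
  have hPc (x y : ℂ) (k j : ℕ) : (P x y ^ k).coeff j = k.choose j * (x ^ j * y ^ (k - j)) := by
    have h (m : ℕ) : (Polynomial.C x * Polynomial.X) ^ m * Polynomial.C y ^ (k - m)
        * (k.choose m : Polynomial ℂ)
        = Polynomial.monomial m (k.choose m * (x ^ m * y ^ (k - m)) : ℂ) := by
      rw [← Polynomial.C_mul_X_pow_eq_monomial]
      simp only [map_mul, map_pow, map_natCast]
      ring
    simp only [hP, add_pow, h, Polynomial.finsetSum_coeff, Polynomial.coeff_monomial]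
    rw [Finset.sum_ite_eq' (Finset.range (k + 1)) j]
    split_ifs with hj
    · rfl
    · rw [Nat.choose_eq_zero_of_lt (by simpa using hj)]
      simp
  have hQd : Q.natDegree < N + n + 1 :=
    Nat.lt_succ_of_le (Polynomial.natDegree_mul_le_of_le (hPd _ _ _) (hPd _ _ _))
  have key : ∀ t : ℂ, ∑ j ∈ Finset.range (N + n + 1), t ^ j * (((N + n).choose j : ℂ) * G j)
      = ∑ j ∈ Finset.range (N + n + 1), t ^ j * (Q.coeff j * sphereMoment H (N + n)) := by
    intro t
    -- The inner product is conjugate-linear on the left, so the coefficient t̄ makes both sides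
    -- polynomials in t; the right one is Q times the moment.
    have h := integral_inner_pow_mul N n (conj t • w + b) a v
    simp_rw [inner_add_left, inner_smul_left, Complex.conj_conj, add_pow _ _ (N + n),
      Finset.sum_mul] at h
    rw [integral_finsetSum _ fun j _ => integrable_sphere (by fun_prop)] at h
    convert h using 1
    · refine Finset.sum_congr rfl fun j _ => ?_
      rw [hG, ← mul_assoc, ← integral_const_mul]
      refine integral_congr_ae (.of_forall fun u => ?_)
      simp only [mul_pow]
      ring
    · have h1 : Q.eval t = (t * inner ℂ w a + inner ℂ b a) ^ N
          * (t * inner ℂ w v + inner ℂ b v) ^ n := by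
        simp only [hQ, hP, Polynomial.eval_mul, Polynomial.eval_pow, Polynomial.eval_add,
          Polynomial.eval_C, Polynomial.eval_X, mul_comm t]
      rw [← h1, Polynomial.eval_eq_sum_range' hQd, Finset.sum_mul]
      exact Finset.sum_congr rfl fun j _ => by ring
  have h := coeff_eq_of_forall_sum_eq key (Nat.le_add_left n N)
  simp only [hG, Nat.add_sub_cancel] at h
  simp_rw [mul_comm (inner ℂ b _ ^ N)]
  rw [h, mul_comm, hQ, Polynomial.coeff_mul, Finset.Nat.sum_antidiagonal_eq_sum_range_succ_mk]
  congr 1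
  refine Finset.sum_congr rfl fun l hl => ?_
  have hl' := Finset.mem_range_succ_iff.1 hl
  rw [hPc, hPc, Nat.choose_symm hl', Nat.sub_sub_self hl']
  ring

/-- Take n = 1, a = b = e, v = w = f_i in the mixed moments and sum over an orthonormal basis. On
the sphere ∑ |⟨f_i,u⟩|² = 1 lowers the degree on the left; on the right the term ℓ = 0 contributes d
and the term ℓ = 1 contributes k. -/
theorem sphereMoment_succ [Nontrivial H] (k : ℕ) :
    ((k : ℂ) + Module.finrank ℂ H) * sphereMoment H (k + 1) = (k + 1) * sphereMoment H k := by
  set e : H := (exists_norm_eq H zero_le_one).choose with hed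
  have he : ‖e‖ = 1 := (exists_norm_eq H zero_le_one).choose_spec
  have hee : inner ℂ e e = (1 : ℂ) := by rw [inner_self_eq_norm_sq_to_K, he]; simp
  set f := stdOrthonormalBasis ℂ H
  have h1 (i) := integral_inner_pow_mul_pow_mul k 1 e (f i) e (f i)
  have h2 : ∑ i, ∫ u : sphere (0 : H) 1, inner ℂ e (u : H) ^ k * inner ℂ (f i) (u : H) ^ 1 *
        (inner ℂ (u : H) e ^ k * inner ℂ (u : H) (f i) ^ 1) ∂(uniformSphere H)
      = sphereMoment H k := by
    rw [← integral_finsetSum _ fun j _ => integrable_sphere (by fun_prop)]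
    refine integral_congr_ae (.of_forall fun u => ?_)
    have hu : ∑ i, inner ℂ (u : H) (f i) * inner ℂ (f i) (u : H) = 1 := by
      rw [f.sum_inner_mul_inner, inner_self_eq_norm_sq_to_K, norm_eq_of_mem_sphere]; simp
    simp only
    rw [← mul_one (inner ℂ e (u : H) ^ k * inner ℂ (u : H) e ^ k), ← hu, Finset.mul_sum]
    exact Finset.sum_congr rfl fun i _ => by ring
  have h3 : ∑ i, inner ℂ e (f i) * inner ℂ (f i) e = 1 := by
    rw [f.sum_inner_mul_inner, hee]
  have h4 (i) : inner ℂ (f i) (f i) = (1 : ℂ) := by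
    rw [inner_self_eq_norm_sq_to_K, f.norm_eq_one]; simp
  have h5 := Finset.sum_congr rfl fun i (_ : i ∈ Finset.univ) => h1 i
  rw [← Finset.mul_sum, h2] at h5
  simp only [Finset.sum_range_succ, Finset.range_zero, Finset.sum_empty, h4, hee, one_pow,
    pow_zero, pow_one, Nat.choose_zero_right, Nat.choose_one_right, Nat.choose_self, mul_one,
    one_mul, zero_add, Nat.cast_one, ← Finset.mul_sum, Finset.sum_add_distrib] at h5
  push_cast at h5
  rw [h5]
  have h6 : ∑ i, inner ℂ (f i) e * inner ℂ e (f i) = (1 : ℂ) := by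
    rw [← h3]; exact Finset.sum_congr rfl fun i _ => mul_comm _ _
  simp only [h6]
  simp
  ring

/-- Iterates `sphereMoment_succ`, whose factors match (n + 1) C(m + 1, n + 1) = (m + 1) C(m, n)
applied to each binomial. -/
theorem sphereMoment_add [Nontrivial H] (N n : ℕ) :
    (((N + n + Module.finrank ℂ H - 1).choose n : ℕ) : ℂ) * sphereMoment H (N + n)
      = ((N + n).choose n : ℕ) * sphereMoment H N := by
  have hd : 0 < Module.finrank ℂ H := Module.finrank_pos
  obtain ⟨d, hd⟩ : ∃ d, Module.finrank ℂ H = d + 1 := ⟨_, (Nat.succ_pred_eq_of_pos hd).symm⟩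
  rw [hd, ← add_assoc, Nat.add_sub_cancel]
  induction n with
  | zero => simp
  | succ n ih =>
    have h := sphereMoment_succ (H := H) (N + n)
    rw [hd] at h
    have h1 : (((N + n + 1 + d).choose (n + 1) : ℕ) : ℂ) * (n + 1)
        = (N + n + 1 + d) * ((N + n + d).choose n : ℕ) := by
      have := Nat.add_one_mul_choose_eq (N + n + d) n
      rw [show N + n + 1 + d = (N + n + d) + 1 by omega]
      have h2 := congrArg (Nat.cast : ℕ → ℂ) this
      push_cast at h2 ⊢
      linear_combination -h2
    have h3 : (((N + n + 1).choose (n + 1) : ℕ) : ℂ) * (n + 1)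
        = (N + n + 1) * ((N + n).choose n : ℕ) := by
      have h2 := congrArg (Nat.cast : ℕ → ℂ) (Nat.add_one_mul_choose_eq (N + n) n)
      push_cast at h2 ⊢
      linear_combination -h2
    have h0 : (n + 1 : ℂ) ≠ 0 := by exact_mod_cast Nat.succ_ne_zero n
    refine mul_right_cancel₀ h0 ?_
    rw [← add_assoc]
    push_cast at h ⊢
    linear_combination sphereMoment H (N + n + 1) * h1 - sphereMoment H N * h3
      + ((N + n + d).choose n : ℂ) * h + (N + n + 1 : ℂ) * ih

end Sphere

/-! ### Operators on tensor powers and the rank-one case -/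

section TensorOperators

variable {H : Type*} [NormedAddCommGroup H] [InnerProductSpace ℂ H] [FiniteDimensional ℂ H]

/-- `|a^{⊗n}⟩⟨b^{⊗n}|` as an operator on `H^{⊗n}`. -/
def powRankOne (n : ℕ) (a b : H) : Module.End ℂ (TensorPow H n) :=
  (InnerProductSpace.rankOne ℂ (elemTensor fun _ : Fin n => a)
    (elemTensor fun _ : Fin n => b)).toLinearMap

theorem TensorPow.inner_add_left {n : ℕ} (x y z : TensorPow H n) :
    inner ℂ (x + y) z = inner ℂ x z + inner ℂ y z :=
  _root_.inner_add_left x y z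

theorem TensorPow.inner_sub_right {n : ℕ} (x y z : TensorPow H n) :
    inner ℂ x (y - z) = inner ℂ x y - inner ℂ x z :=
  _root_.inner_sub_right x y z

theorem TensorPow.inner_smul_left {n : ℕ} (c : ℂ) (x y : TensorPow H n) :
    inner ℂ (c • x) y = conj c * inner ℂ x y :=
  _root_.inner_smul_left x y c

theorem TensorPow.inner_smul_right {n : ℕ} (c : ℂ) (x y : TensorPow H n) :
    inner ℂ x (c • y) = c * inner ℂ x y :=
  _root_.inner_smul_right x y c

theorem TensorPow.inner_sum {n : ℕ} {ι : Type*} [Fintype ι] (x : TensorPow H n)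
    (f : ι → TensorPow H n) : inner ℂ x (∑ i, f i) = ∑ i, inner ℂ x (f i) :=
  _root_.inner_sum Finset.univ f x

theorem powRankOne_apply (n : ℕ) (a b : H) (x : TensorPow H n) :
    powRankOne n a b x = inner ℂ (elemTensor fun _ => b) x • elemTensor fun _ => a :=
  rfl

theorem span_elemTensor (n : ℕ) :
    Submodule.span ℂ (Set.range (elemTensor : (Fin n → H) → TensorPow H n)) = ⊤ :=
  PiTensorProduct.span_tprod_eq_top

/-- Linear maps that agree on elementary tensors are equal. -/
theorem linearMap_ext_elemTensor {E : Type*} [AddCommMonoid E] [Module ℂ E] {n : ℕ}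
    {f g : TensorPow H n →ₗ[ℂ] E} (h : ∀ v, f (elemTensor v) = g (elemTensor v)) : f = g :=
  LinearMap.ext_on (span_elemTensor n) (by rintro _ ⟨v, rfl⟩; exact h v)

theorem permTensor_elemTensor {n : ℕ} (σ : Equiv.Perm (Fin n)) (v : Fin n → H) :
    permTensor σ (elemTensor v) = elemTensor fun i => v (σ.symm i) :=
  PiTensorProduct.reindex_tprod (R := ℂ) (s := fun _ : Fin n => H) σ v

/-- Vectors of `H_s^n` do not distinguish between permutations of an elementary tensor. -/
theorem inner_elemTensor_comp_perm {n : ℕ} {x : TensorPow H n} (hx : x ∈ bosonSpace H n)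
    (σ : Equiv.Perm (Fin n)) (v : Fin n → H) :
    inner ℂ x (elemTensor fun i => v (σ i)) = inner ℂ x (elemTensor v) := by
  have h : ∀ y : TensorPow H n, inner ℂ (permTensor σ⁻¹ y) (elemTensor fun i => v (σ i))
      = inner ℂ y (elemTensor v) := by
    intro y
    have hy : y ∈ Submodule.span ℂ (Set.range (elemTensor : (Fin n → H) → TensorPow H n)) := by
      rw [span_elemTensor]; trivial
    induction hy using Submodule.span_induction with
    | mem _ h =>
      obtain ⟨w, rfl⟩ := h
      rw [permTensor_elemTensor, inner_elemTensor, inner_elemTensor]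
      exact Equiv.prod_comp σ fun i => inner ℂ (w i) (v i)
    | zero => simp
    | add a b _ _ ha hb => rw [map_add, TensorPow.inner_add_left, TensorPow.inner_add_left, ha, hb]
    | smul c a _ ha => rw [map_smul, TensorPow.inner_smul_left, TensorPow.inner_smul_left, ha]
  rw [← h x, hx σ⁻¹]

/-- Continuity allows the multilinear form v ↦ ⟨x, v₁ ⊗ ⋯ ⊗ vₙ⟩ to be differentiated along the
diagonal in `span_bosonPow`. -/
theorem continuous_inner_elemTensor {n : ℕ} (x : TensorPow H n) :
    Continuous fun v : Fin n → H => inner ℂ x (elemTensor v) := by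
  have h (v : Fin n → H) : inner ℂ x (elemTensor v)
      = ∑ p, conj ((tensorPowBasis H n).repr x p) *
          ∏ i, inner ℂ (stdOrthonormalBasis ℂ H (p i)) (v i) := by
    change ∑ p, conj ((tensorPowBasis H n).repr x p)
      * (tensorPowBasis H n).repr (PiTensorProduct.tprod ℂ v) p = _
    simp_rw [tensorPowBasis_repr_tprod]
  simp_rw [h]
  fun_prop

/-- The vectors `u^{⊗n}` span `H_s^n`. -/
theorem span_bosonPow (n : ℕ) : Submodule.span ℂ (Set.range (bosonPow (H := H) n)) = ⊤ := by
  rw [← Submodule.orthogonal_eq_bot_iff, Submodule.eq_bot_iff]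
  intro x hx
  have h0 (u : H) : inner ℂ (x : TensorPow H n) (elemTensor fun _ => u) = 0 :=
    Submodule.inner_left_of_mem_orthogonal (u := bosonPow n u)
      (Submodule.subset_span (Set.mem_range_self u)) hx
  let f : MultilinearMap ℂ (fun _ : Fin n => H) ℂ :=
    ((innerₛₗ ℂ (x : TensorPow H n)) ∘ₗ
      (TensorPow.equivPi H n).symm.toLinearMap).compMultilinearMap (PiTensorProduct.tprod ℂ)
  let F : ContinuousMultilinearMap ℂ (fun _ : Fin n => H) ℂ :=
    ⟨f, continuous_inner_elemTensor x.1⟩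
  have hF (v : Fin n → H) : F v = inner ℂ (x : TensorPow H n) (elemTensor v) := rfl
  have h1 (v : Fin n → H) : inner ℂ (x : TensorPow H n) (elemTensor v) = 0 := by
    -- The n-th derivative of u ↦ F(u,…,u) = 0 is the sum of F(v ∘ σ) over all σ, which equals n!
    -- F(v) because x is symmetric.
    have h := F.iteratedFDeriv_comp_diagonal 0 v
    simp only [hF, h0, inner_elemTensor_comp_perm x.2] at h
    simpa [Fintype.card_perm, Nat.factorial_ne_zero] using h.symm
  have h2 : innerₛₗ ℂ (x : TensorPow H n) = 0 := linearMap_ext_elemTensor h1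
  have h3 := LinearMap.congr_fun h2 (x : TensorPow H n)
  exact Subtype.ext (inner_self_eq_zero.1 h3)

/-- Operators on `H_s^N` are linear combinations of the `|a^{⊗N}⟩⟨b^{⊗N}|`. -/
theorem linearMap_ext_rankOne_bosonPow {E : Type*} [AddCommGroup E] [Module ℂ E] {N : ℕ}
    {f g : (bosonSpace H N →L[ℂ] bosonSpace H N) →ₗ[ℂ] E}
    (h : ∀ a b : H, f (InnerProductSpace.rankOne ℂ (bosonPow N a) (bosonPow N b))
      = g (InnerProductSpace.rankOne ℂ (bosonPow N a) (bosonPow N b))) : f = g := by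
  have h1 (x y : bosonSpace H N) :
      f (InnerProductSpace.rankOne ℂ x y) = g (InnerProductSpace.rankOne ℂ x y) := by
    have hx : x ∈ Submodule.span ℂ (Set.range (bosonPow (H := H) N)) := by
      rw [span_bosonPow]; trivial
    have hy : y ∈ Submodule.span ℂ (Set.range (bosonPow (H := H) N)) := by
      rw [span_bosonPow]; trivial
    induction hx using Submodule.span_induction with
    | mem _ hx =>
      obtain ⟨a, rfl⟩ := hx
      induction hy using Submodule.span_induction with
      | mem _ hy =>
        obtain ⟨b, rfl⟩ := hy
        exact h a b
      | zero => simp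
      | add y z _ _ hy hz => simp only [map_add, hy, hz]
      | smul c y _ hy => rw [map_smulₛₗ, map_smul, map_smul, hy]
    | zero => simp
    | add y z _ _ hy hz => simp only [map_add, add_apply, hy, hz]
    | smul c y _ hy =>
      simp only [map_smul, smul_apply, hy]
  ext Γ
  have hΓ : Γ = ∑ i, InnerProductSpace.rankOne ℂ (Γ (stdOrthonormalBasis ℂ (bosonSpace H N) i))
      (stdOrthonormalBasis ℂ (bosonSpace H N) i) := by
    ext1 x
    nth_rewrite 1 [← (stdOrthonormalBasis ℂ (bosonSpace H N)).sum_repr' x]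
    simp
  rw [hΓ, map_sum, map_sum]
  exact Finset.sum_congr rfl fun i _ => h1 _ _

theorem extendByZero_rankOne {N : ℕ} (x y : bosonSpace H N) :
    extendByZero (InnerProductSpace.rankOne ℂ x y)
      = (InnerProductSpace.rankOne ℂ (x : TensorPow H N) (y : TensorPow H N)).toLinearMap := by
  refine LinearMap.ext fun z => ?_
  change (((InnerProductSpace.rankOne ℂ x y)
    ((bosonSpace H N).orthogonalProjectionOnto z) : bosonSpace H N) : TensorPow H N) = _
  simp

theorem inner_elemTensor_const {n : ℕ} (a b : H) :
    inner ℂ (elemTensor fun _ : Fin n => a) (elemTensor fun _ => b) = inner ℂ a b ^ n := by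
  rw [inner_elemTensor, Finset.prod_const, Finset.card_fin]

theorem trace_powRankOne (n : ℕ) (a b : H) :
    LinearMap.trace ℂ _ (powRankOne n a b) = inner ℂ b a ^ n :=
  (InnerProductSpace.trace_rankOne _ _).trans (inner_elemTensor_const b a)

/-- Constant families do not see which positions go to which factor. The factorization lets a
partial trace be read off from `partialTraceRight_map`. -/
theorem splitTensor_conj_powRankOne {k m n : ℕ} (e : Fin k ⊕ Fin m ≃ Fin n) (a b : H) :
    (splitTensor e).conj (TensorProduct.map (powRankOne k a b) (powRankOne m a b))
      = powRankOne n a b := by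
  have h : (splitTensor (H := H) e).toLinearMap ∘ₗ
      TensorProduct.map (powRankOne k a b) (powRankOne m a b)
      = powRankOne n a b ∘ₗ (splitTensor (H := H) e).toLinearMap := by
    refine TensorProduct.ext (linearMap_ext_elemTensor fun v =>
      linearMap_ext_elemTensor fun w => ?_)
    simp only [LinearMap.compr₂ₛₗ_apply, TensorProduct.mk_apply, LinearMap.comp_apply,
      TensorProduct.map_tmul, powRankOne_apply, LinearEquiv.coe_coe, splitTensor_tmul,
      TensorProduct.smul_tmul_smul, map_smul, inner_elemTensor]
    congr 1
    · rw [← Equiv.prod_comp e]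
      simp
    · refine congrArg elemTensor (funext fun i => ?_)
      rcases e.symm i <;> rfl
  refine LinearMap.ext fun z => ?_
  rw [LinearEquiv.conj_apply_apply]
  refine (LinearMap.congr_fun h ((splitTensor e).symm z)).trans ?_
  simp

/-- The reduced density matrices of `|a^{⊗N}⟩⟨b^{⊗N}|`. -/
theorem reducedDensity_rankOne {n N : ℕ} (h : n ≤ N) (a b : H) :
    reducedDensity h (InnerProductSpace.rankOne ℂ (bosonPow N a) (bosonPow N b))
      = inner ℂ b a ^ (N - n) • powRankOne n a b := by
  rw [reducedDensity, extendByZero_rankOne, partialTrace]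
  change partialTraceRight _ _ ((splitTensor (firstLast h)).symm.conj
    (powRankOne N a b)) = _
  rw [← splitTensor_conj_powRankOne (firstLast h), LinearEquiv.conj_symm_conj,
    partialTraceRight_map, trace_powRankOne]

/-- The reduced density matrix as a linear function of the state. -/
def reducedDensityLin {n N : ℕ} (h : n ≤ N) :
    (bosonSpace H N →L[ℂ] bosonSpace H N) →ₗ[ℂ] Module.End ℂ (TensorPow H n) where
  toFun := reducedDensity h
  map_add' Γ Δ := by
    have : extendByZero (Γ + Δ) = extendByZero Γ + extendByZero Δ := by
      ext; simp [extendByZero]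
    simp [reducedDensity, partialTrace, this]
  map_smul' c Γ := by
    have : extendByZero (c • Γ) = c • extendByZero Γ := by
      ext; simp [extendByZero]
    simp [reducedDensity, partialTrace, this]

/-- `A ⊗_s B` as a linear function of `A`. -/
def symTensorLin {k n : ℕ} (h : k ≤ n) (B : Module.End ℂ (TensorPow H (n - k))) :
    Module.End ℂ (TensorPow H k) →ₗ[ℂ] Module.End ℂ (TensorPow H n) where
  toFun A := symTensor h A B
  map_add' A A' := by
    simp [symTensor, actOn, TensorProduct.map_add_left, Finset.sum_add_distrib]
  map_smul' c A := by
    simp only [symTensor, actOn, TensorProduct.map_smul_left, map_smul, ← Finset.smul_sum,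
      RingHom.id_apply]
    rw [smul_comm]

theorem actOn_rankOne_one {k m n : ℕ} (e : Fin k ⊕ Fin m ≃ Fin n) (a b v : H) :
    actOn e (powRankOne k a b) 1 (elemTensor fun _ => v)
      = inner ℂ b v ^ k • elemTensor fun i =>
          Sum.elim (fun _ : Fin k => a) (fun _ : Fin m => v) (e.symm i) := by
  have h : (splitTensor e).symm (elemTensor fun _ => v)
      = elemTensor (fun _ : Fin k => v) ⊗ₜ[ℂ] elemTensor (fun _ : Fin m => v) := by
    rw [LinearEquiv.symm_apply_eq, splitTensor_tmul]
    refine congrArg elemTensor (funext fun i => ?_)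
    rcases e.symm i <;> rfl
  rw [actOn, LinearEquiv.conj_apply_apply, h, TensorProduct.map_tmul,
    powRankOne_apply, inner_elemTensor_const, Module.End.one_apply,
    ← TensorProduct.smul_tmul', map_smul, splitTensor_tmul]

/-- A permutation τ only reindexes the sum over S_n by σ ↦ τσ. -/
theorem symTensor_rankOne_mem_bosonSpace {k n : ℕ} (h : k ≤ n) (a b v : H) :
    symTensor h (powRankOne k a b) 1 (elemTensor fun _ => v) ∈ bosonSpace H n := by
  rw [symTensor, LinearMap.smul_apply, LinearMap.sum_apply]
  refine Submodule.smul_mem _ _ fun τ => ?_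
  simp_rw [actOn_rankOne_one, map_sum, map_smul, permTensor_elemTensor]
  exact Fintype.sum_equiv (Equiv.mulLeft τ) _ _ fun σ => rfl

/-- Against w^{⊗n} all n! summands have the same matrix element, and n! / (k! (n - k)!) is the
binomial coefficient. -/
theorem inner_symTensor_rankOne {k n : ℕ} (h : k ≤ n) (a b v w : H) :
    inner ℂ (elemTensor fun _ => w)
      (symTensor h (powRankOne k a b) 1 (elemTensor fun _ => v))
      = (n.choose k : ℂ) * (inner ℂ w a ^ k * (inner ℂ w v ^ (n - k) * inner ℂ b v ^ k)) := by
  have h1 (e : Fin k ⊕ Fin (n - k) ≃ Fin n) : inner ℂ (elemTensor fun _ => w)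
      (actOn e (powRankOne k a b) 1 (elemTensor fun _ => v))
      = inner ℂ w a ^ k * (inner ℂ w v ^ (n - k) * inner ℂ b v ^ k) := by
    rw [actOn_rankOne_one, TensorPow.inner_smul_right, inner_elemTensor, ← Equiv.prod_comp e]
    simp
    ring
  rw [symTensor, LinearMap.smul_apply, LinearMap.sum_apply, TensorPow.inner_smul_right,
    TensorPow.inner_sum]
  simp_rw [h1]
  rw [Finset.sum_const, Finset.card_univ, Fintype.card_perm, Fintype.card_fin, nsmul_eq_mul,
    ← mul_assoc, Nat.choose_eq_factorial_div_factorial h,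
    Nat.cast_div (Nat.factorial_mul_factorial_dvd_factorial h)
      (by exact_mod_cast (Nat.mul_pos k.factorial_pos (n - k).factorial_pos).ne'),
    div_eq_inv_mul]

end TensorOperators

/-! ### Normalization, and the formula by linearity -/

section Chiribella

open MeasureTheory Metric

variable {H : Type*} [NormedAddCommGroup H] [InnerProductSpace ℂ H] [FiniteDimensional ℂ H]
  [MeasurableSpace H] [BorelSpace H] [Nontrivial H]

/-- `dim(H_s^N) ∫ |u^{⊗N}⟩⟨u^{⊗N}| du = 1`, through the trace. -/
theorem finrank_bosonSpace_mul_sphereMoment (N : ℕ) :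
    (Module.finrank ℂ (bosonSpace H N) : ℂ) * sphereMoment H N = 1 := by
  have hc : Continuous fun u : sphere (0 : H) 1 => bosonPow N (u : H) :=
    (continuous_bosonPow N).comp continuous_subtype_val
  -- Sesquilinear extension of `integral_inner_pow` from the spanning vectors u^{⊗N}. Its trace is
  -- then computed in two ways, using ‖u^{⊗N}‖ = 1 on the sphere.
  have h (x y : bosonSpace H N) : ∫ u : sphere (0 : H) 1, inner ℂ x (bosonPow N (u : H)) *
      inner ℂ (bosonPow N (u : H)) y ∂(uniformSphere H) = inner ℂ x y * sphereMoment H N := by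
    have hx : x ∈ Submodule.span ℂ (Set.range (bosonPow (H := H) N)) := by
      rw [span_bosonPow]; trivial
    have hy : y ∈ Submodule.span ℂ (Set.range (bosonPow (H := H) N)) := by
      rw [span_bosonPow]; trivial
    induction hx using Submodule.span_induction with
    | mem _ hx =>
      obtain ⟨b, rfl⟩ := hx
      induction hy using Submodule.span_induction with
      | mem _ hy =>
        obtain ⟨a, rfl⟩ := hy
        have h0 (v w : H) : inner ℂ (bosonPow N v) (bosonPow N w) = inner ℂ v w ^ N :=
          inner_elemTensor_const v w
        simp_rw [h0]
        exact integral_inner_pow N b a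
      | zero => simp
      | add y z _ _ hy hz =>
        simp_rw [inner_add_right, mul_add]
        rw [integral_add (integrable_sphere (by fun_prop)) (integrable_sphere (by fun_prop)),
          hy, hz, add_mul]
      | smul c y _ hy =>
        simp_rw [inner_smul_right, mul_left_comm _ c]
        rw [integral_const_mul, hy, mul_assoc]
    | zero => simp
    | add y z _ _ hy hz =>
      simp_rw [inner_add_left, add_mul]
      rw [integral_add (integrable_sphere (by fun_prop)) (integrable_sphere (by fun_prop)),
        hy, hz]
    | smul c y _ hy =>
      simp_rw [inner_smul_left, mul_assoc]
      rw [integral_const_mul, hy]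
  set f := stdOrthonormalBasis ℂ (bosonSpace H N)
  have h1 : ∑ i, ∫ u : sphere (0 : H) 1, inner ℂ (f i) (bosonPow N (u : H)) *
      inner ℂ (bosonPow N (u : H)) (f i) ∂(uniformSphere H) = 1 := by
    rw [← integral_finsetSum _ fun j _ => integrable_sphere (by fun_prop)]
    have hu (u : sphere (0 : H) 1) : ∑ i, inner ℂ (f i) (bosonPow N (u : H)) *
        inner ℂ (bosonPow N (u : H)) (f i) = 1 := by
      simp_rw [mul_comm (inner ℂ (f _) _)]
      rw [f.sum_inner_mul_inner]
      refine (inner_elemTensor_const (u : H) u).trans ?_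
      rw [inner_self_eq_norm_sq_to_K, norm_eq_of_mem_sphere]
      simp
    simp_rw [hu]
    simp
  have h2 (i) : inner ℂ (f i) (f i) = (1 : ℂ) := by
    rw [inner_self_eq_norm_sq_to_K, f.norm_eq_one]; simp
  simp_rw [h, h2, one_mul] at h1
  simpa using h1

variable (H) in
/-- `Γ ↦ Γ̃` as a linear map. -/
def ckmrStateLin (N : ℕ) :
    (bosonSpace H N →L[ℂ] bosonSpace H N) →ₗ[ℂ] (bosonSpace H N →L[ℂ] bosonSpace H N) where
  toFun := ckmrState
  map_add' Γ Δ := by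
    simp only [ckmrState, add_apply, inner_add_right, add_smul]
    rw [integral_add (integrable_ckmr Γ) (integrable_ckmr Δ), smul_add]
  map_smul' c Γ := by
    simp only [ckmrState, smul_apply, inner_smul_right, mul_smul,
      RingHom.id_apply]
    rw [integral_smul, smul_comm]

/-- For a unit vector u, |u^{⊗N}⟩⟨u^{⊗N}| reduces to |u^{⊗n}⟩⟨u^{⊗n}|. The matrix element is a
linear functional on a finite-dimensional space, hence continuous, and passes under the integral. -/
theorem inner_reducedDensity_ckmrState {n N : ℕ} (h : n ≤ N)
    (Γ : bosonSpace H N →L[ℂ] bosonSpace H N) (v w : H) :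
    inner ℂ (elemTensor fun _ : Fin n => w)
        (reducedDensity h (ckmrState Γ) (elemTensor fun _ => v))
      = (Module.finrank ℂ (bosonSpace H N) : ℂ) *
        ∫ u : sphere (0 : H) 1, inner ℂ (bosonPow N (u : H)) (Γ (bosonPow N (u : H))) *
          (inner ℂ w (u : H) ^ n * inner ℂ (u : H) v ^ n) ∂(uniformSphere H) := by
  let φ : (bosonSpace H N →L[ℂ] bosonSpace H N) →ₗ[ℂ] ℂ :=
    innerₛₗ ℂ (elemTensor fun _ : Fin n => w) ∘ₗ
      LinearMap.applyₗ (elemTensor fun _ : Fin n => v) ∘ₗ reducedDensityLin h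
  have hφ (u : sphere (0 : H) 1) :
      φ (InnerProductSpace.rankOne ℂ (bosonPow N (u : H)) (bosonPow N (u : H)))
        = inner ℂ w (u : H) ^ n * inner ℂ (u : H) v ^ n := by
    change inner ℂ (elemTensor fun _ : Fin n => w) (reducedDensity h _ (elemTensor fun _ => v)) = _
    have hu : inner ℂ (u : H) (u : H) = (1 : ℂ) := by
      rw [inner_self_eq_norm_sq_to_K, norm_eq_of_mem_sphere]; simp
    rw [reducedDensity_rankOne, hu, one_pow, one_smul, powRankOne_apply,
      TensorPow.inner_smul_right, inner_elemTensor_const, inner_elemTensor_const, mul_comm]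
  change φ (ckmrState Γ) = _
  rw [ckmrState, map_smul, smul_eq_mul]
  congr 1
  rw [← LinearMap.coe_toContinuousLinearMap' φ,
    ← ContinuousLinearMap.integral_comp_comm _ (integrable_ckmr Γ)]
  refine integral_congr_ae (.of_forall fun u => ?_)
  simp only [LinearMap.coe_toContinuousLinearMap', map_smul, hφ, smul_eq_mul]

omit [MeasurableSpace H] [BorelSpace H] [Nontrivial H] in
theorem reducedDensity_apply_mem_bosonSpace {n N : ℕ} (h : n ≤ N)
    (Γ : bosonSpace H N →L[ℂ] bosonSpace H N) (x : TensorPow H n) :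
    reducedDensity h Γ x ∈ bosonSpace H n := by
  -- Membership in H_s^n is phrased as the vanishing of a map linear in Γ, so that rank-one Γ
  -- suffice.
  have h1 : (bosonSpace H n).mkQ ∘ₗ LinearMap.applyₗ x ∘ₗ reducedDensityLin h = 0 := by
    refine linearMap_ext_rankOne_bosonPow fun a b => ?_
    change (bosonSpace H n).mkQ (reducedDensity h _ x) = 0
    rw [reducedDensity_rankOne, Submodule.mkQ_apply, Submodule.Quotient.mk_eq_zero]
    exact Submodule.smul_mem _ _ (Submodule.smul_mem _ _ (bosonPow n a).2)
  exact (Submodule.Quotient.mk_eq_zero _).1 (LinearMap.congr_fun h1 Γ)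

omit [MeasurableSpace H] [BorelSpace H] [Nontrivial H] in
theorem ext_inner_bosonPow {n : ℕ} {x y : TensorPow H n} (hx : x ∈ bosonSpace H n)
    (hy : y ∈ bosonSpace H n)
    (h : ∀ w : H, inner ℂ (elemTensor fun _ => w) x = inner ℂ (elemTensor fun _ => w) y) :
    x = y := by
  have h1 : (⟨x - y, sub_mem hx hy⟩ : bosonSpace H n)
      ∈ (Submodule.span ℂ (Set.range (bosonPow (H := H) n)))ᗮ := by
    rw [Submodule.mem_orthogonal]
    intro z hz
    induction hz using Submodule.span_induction with
    | mem _ hz =>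
      obtain ⟨w, rfl⟩ := hz
      change inner ℂ (elemTensor fun _ => w) (x - y) = 0
      rw [TensorPow.inner_sub_right, h, sub_self]
    | zero => simp
    | add a b _ _ ha hb => rw [inner_add_left, ha, hb, add_zero]
    | smul c a _ ha => rw [inner_smul_left, ha, mul_zero]
  rw [span_bosonPow, Submodule.top_orthogonal_eq_bot, Submodule.mem_bot] at h1
  exact sub_eq_zero.1 (congrArg Subtype.val h1)

/-- The formula for `Γ = |a^{⊗N}⟩⟨b^{⊗N}|`, on the vectors `v^{⊗n}`. -/
theorem reducedDensity_ckmrState_rankOne {N n : ℕ} (hn : n ≤ N) (a b v : H) :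
    reducedDensity hn (ckmrState (InnerProductSpace.rankOne ℂ (bosonPow N a) (bosonPow N b)))
        (elemTensor fun _ => v)
      = ((Nat.choose (N + n + Module.finrank ℂ H - 1) n : ℕ) : ℂ)⁻¹ •
          ∑ l : Fin (n + 1), ((Nat.choose N (l : ℕ) : ℕ) : ℂ) •
            symTensor (Nat.le_of_lt_succ l.isLt)
              (reducedDensity ((Nat.le_of_lt_succ l.isLt).trans hn)
                (InnerProductSpace.rankOne ℂ (bosonPow N a) (bosonPow N b))) 1
              (elemTensor fun _ => v) := by
  have hsym (l : Fin (n + 1)) : symTensor (Nat.le_of_lt_succ l.isLt)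
        (reducedDensity ((Nat.le_of_lt_succ l.isLt).trans hn)
          (InnerProductSpace.rankOne ℂ (bosonPow N a) (bosonPow N b))) 1 (elemTensor fun _ => v)
      = inner ℂ b a ^ (N - l) • symTensor (Nat.le_of_lt_succ l.isLt) (powRankOne l a b) 1
          (elemTensor fun _ => v) := by
    rw [reducedDensity_rankOne]
    exact LinearMap.congr_fun ((symTensorLin (H := H) (Nat.le_of_lt_succ l.isLt) 1).map_smul _ _) _
  simp_rw [hsym]
  refine ext_inner_bosonPow (reducedDensity_apply_mem_bosonSpace hn _ _)
    (Submodule.smul_mem _ _ (Submodule.sum_mem _ fun l _ => Submodule.smul_mem _ _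
      (Submodule.smul_mem _ _ (symTensor_rankOne_mem_bosonSpace _ a b v)))) fun w => ?_
  have hJ : ∫ u : sphere (0 : H) 1, inner ℂ (bosonPow N (u : H))
        (InnerProductSpace.rankOne ℂ (bosonPow N a) (bosonPow N b) (bosonPow N (u : H))) *
          (inner ℂ w (u : H) ^ n * inner ℂ (u : H) v ^ n) ∂(uniformSphere H)
      = ∫ u : sphere (0 : H) 1, inner ℂ b (u : H) ^ N * inner ℂ w (u : H) ^ n *
        (inner ℂ (u : H) a ^ N * inner ℂ (u : H) v ^ n) ∂(uniformSphere H) := by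
    refine integral_congr_ae (.of_forall fun u => ?_)
    have h0 (v w : H) : inner ℂ (bosonPow N v) (bosonPow N w) = inner ℂ v w ^ N :=
      inner_elemTensor_const v w
    simp only [InnerProductSpace.inner_right_rankOne_apply, h0]
    ring
  rw [inner_reducedDensity_ckmrState, hJ, TensorPow.inner_smul_right, TensorPow.inner_sum]
  simp_rw [TensorPow.inner_smul_right, inner_symTensor_rankOne]
  have h1 := integral_inner_pow_mul_pow_mul N n b w a v
  have h2 := sphereMoment_add (H := H) N n
  have h3 := finrank_bosonSpace_mul_sphereMoment (H := H) N
  rw [Finset.sum_range] at h1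
  have h4 : ((N + n).choose n : ℂ) ≠ 0 :=
    Nat.cast_ne_zero.2 (Nat.choose_pos (Nat.le_add_left n N)).ne'
  have hd : 0 < Module.finrank ℂ H := Module.finrank_pos
  have h5 : (((N + n + Module.finrank ℂ H - 1).choose n : ℕ) : ℂ) ≠ 0 :=
    Nat.cast_ne_zero.2 (Nat.choose_pos (by omega)).ne'
  have h6 : ∑ l : Fin (n + 1), (N.choose l : ℂ) * (inner ℂ b a ^ (N - (l : ℕ)) *
        ((n.choose l : ℂ) * (inner ℂ w a ^ (l : ℕ) *
          (inner ℂ w v ^ (n - (l : ℕ)) * inner ℂ b v ^ (l : ℕ)))))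
      = ∑ l : Fin (n + 1), (N.choose l : ℂ) * (n.choose l : ℂ) *
          (inner ℂ w a ^ (l : ℕ) * inner ℂ b a ^ (N - (l : ℕ)) *
            (inner ℂ w v ^ (n - (l : ℕ)) * inner ℂ b v ^ (l : ℕ))) :=
    Finset.sum_congr rfl fun l _ => by ring
  rw [h6, eq_inv_mul_iff_mul_eq₀ h5]
  refine mul_left_cancel₀ h4 ?_
  generalize ∑ l : Fin (n + 1), (N.choose l : ℂ) * (n.choose l : ℂ) *
          (inner ℂ w a ^ (l : ℕ) * inner ℂ b a ^ (N - (l : ℕ)) *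
            (inner ℂ w v ^ (n - (l : ℕ)) * inner ℂ b v ^ (l : ℕ))) = S at h1 ⊢
  -- With B = C(N+n+d-1, n), C = C(N+n, n), D = dim H_s^N and I the integral: B D (C I) = D B
  -- c_{N+n} S = D C c_N S = C S.
  linear_combination (((N + n + Module.finrank ℂ H - 1).choose n : ℕ) : ℂ) *
    (Module.finrank ℂ (bosonSpace H N) : ℂ) * h1
    + (Module.finrank ℂ (bosonSpace H N) : ℂ) * S * h2 + ((N + n).choose n : ℂ) * S * h3

end Chiribella

theorem mainTheorem6 {H : Type*} [NormedAddCommGroup H] [InnerProductSpace ℂ H]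
    [FiniteDimensional ℂ H] [Nontrivial H] [MeasurableSpace H] [BorelSpace H]
    (N n : ℕ) (hn : n ≤ N) (Γ : bosonSpace H N →L[ℂ] bosonSpace H N) (hΓ : IsBosonicState Γ) :
    ∀ ψ ∈ bosonSpace H n,
      reducedDensity hn (ckmrState Γ) ψ
        = ((Nat.choose (N + n + Module.finrank ℂ H - 1) n : ℕ) : ℂ)⁻¹ •
          ∑ l : Fin (n + 1), ((Nat.choose N (l : ℕ) : ℕ) : ℂ) •
            symTensor (Nat.le_of_lt_succ l.isLt)
              (reducedDensity ((Nat.le_of_lt_succ l.isLt).trans hn) Γ) 1 ψ := by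
  let F : (bosonSpace H N →L[ℂ] bosonSpace H N) →ₗ[ℂ] Module.End ℂ (TensorPow H n) :=
    reducedDensityLin hn ∘ₗ ckmrStateLin H N
  let G : (bosonSpace H N →L[ℂ] bosonSpace H N) →ₗ[ℂ] Module.End ℂ (TensorPow H n) :=
    ((Nat.choose (N + n + Module.finrank ℂ H - 1) n : ℕ) : ℂ)⁻¹ •
      ∑ l : Fin (n + 1), ((Nat.choose N (l : ℕ) : ℕ) : ℂ) •
        ((symTensorLin (H := H) (Nat.le_of_lt_succ l.isLt) 1 : _ →ₗ[ℂ] _) ∘ₗ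
          reducedDensityLin (H := H) ((Nat.le_of_lt_succ l.isLt).trans hn))
  have hG (Δ : bosonSpace H N →L[ℂ] bosonSpace H N) (x : TensorPow H n) : G Δ x
      = ((Nat.choose (N + n + Module.finrank ℂ H - 1) n : ℕ) : ℂ)⁻¹ •
          ∑ l : Fin (n + 1), ((Nat.choose N (l : ℕ) : ℕ) : ℂ) •
            symTensor (Nat.le_of_lt_succ l.isLt)
              (reducedDensity ((Nat.le_of_lt_succ l.isLt).trans hn) Δ) 1 x := by
    simp only [G, LinearMap.smul_apply, LinearMap.sum_apply]
    rfl
  have h1 (v : H) : LinearMap.applyₗ (elemTensor fun _ : Fin n => v) ∘ₗ F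
      = LinearMap.applyₗ (elemTensor fun _ : Fin n => v) ∘ₗ G :=
    linearMap_ext_rankOne_bosonPow fun a b =>
      (reducedDensity_ckmrState_rankOne hn a b v).trans (hG _ _).symm
  -- Agreement on the vectors v^{⊗n} determines the operators only on their span H_s^n, hence the
  -- restriction.
  have h2 : F Γ ∘ₗ (bosonSpace H n).subtype = G Γ ∘ₗ (bosonSpace H n).subtype := by
    refine LinearMap.ext_on (span_bosonPow n) ?_
    rintro _ ⟨v, rfl⟩
    exact LinearMap.congr_fun (h1 v) Γ
  intro ψ hψ
  exact (LinearMap.congr_fun h2 ⟨ψ, hψ⟩).trans (hG Γ ψ)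

end
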